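/- Let $k$ be an algebraically closed field of characteristic zero. A $k$-variety is a reduced separated scheme of finite type over $k$. Let $K_0(\mathcal V_k)$ be the Grothendieck ring of $k$-varieties: the abelian group generated by the isomorphism classes $[X]$ of $k$-varieties, subject to the relations $[X\setminus Y]=[X]-[Y]$ for every variety $X$ and every closed subvariety $Y\subseteq X$, with multiplication induced by $[X][Y]=[X\times_k Y]$. Let $\mathbb L=[\mathbb A^1_k]$. Let $G$ be a finite abelian group acting linearly, through a representation, on a $k$-vector space $V$ of finite dimension $n$. Regard $V$ as the affine variety $\operatorname{Spec}k[V]$ with $k[V]=\operatorname{Sym}(V^*)$, and let $\overline V=G\backslash V=\operatorname{Spec}\bigl(k[V]^G\bigr)$ be its orbit space, where $k[V]^G$ is the ring of invariant functions. Then $$[\overline V]=\mathbb L^n\quad\text{in } K_0(\mathcal V_k).$$ -/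

import Mathlib

open CategoryTheory MonoidalCategory CartesianMonoidalCategory AlgebraicGeometry
open scoped TensorProduct

universe u w

noncomputable section

namespace Motivic

/-! ### Varieties -/

section Varieties

variable (k : Type u) [Field k]

/-- A `k`-scheme is a `k`-variety if it is reduced, separated and of finite type over `k`.
(It need not be irreducible.) -/
structure IsVariety (X : Over (Spec (CommRingCat.of k))) : Prop where
  isReduced : IsReduced X.left
  isSeparated : IsSeparated X.hom
  locallyOfFiniteType : LocallyOfFiniteType X.hom
  quasiCompact : QuasiCompact X.hom

/-- Being a `k`-variety, as a property of objects of the category of `k`-schemes. -/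
def isVariety : ObjectProperty (Over (Spec (CommRingCat.of k))) := fun X => IsVariety k X

/-- The category `𝒱_k` of `k`-varieties: a full subcategory of the `k`-schemes. -/
abbrev Variety : Type (u + 1) := (isVariety k).FullSubcategory

/-- The affine `k`-variety `Spec A` of a reduced `k`-algebra `A` of finite type. -/
def Variety.ofAlgebra (A : Type u) [CommRing A] [Algebra k A] [_root_.IsReduced A]
    [hA : Algebra.FiniteType k A] : Variety k where
  obj := Over.mk (Spec.map (CommRingCat.ofHom (algebraMap k A)))
  property :=
    { isReduced := inferInstanceAs (IsReduced (Spec (CommRingCat.of A)))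
      isSeparated := inferInstanceAs
        (IsSeparated (Spec.map (CommRingCat.ofHom (algebraMap k A))))
      locallyOfFiniteType := by
        refine (HasRingHomProperty.Spec_iff (P := @LocallyOfFiniteType)).mpr ?_
        exact (RingHom.finiteType_algebraMap).mpr hA
      quasiCompact := inferInstanceAs
        (QuasiCompact (Spec.map (CommRingCat.ofHom (algebraMap k A)))) }

end Varieties

/-! ### The product of two varieties over an algebraically closed field is a variety -/

section Product

variable {k : Type u} [Field k] [IsAlgClosed k]

/-- Over an algebraically closed field, a function on a reduced affine variety that vanishes at all
rational points is zero. -/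
theorem eq_zero_of_forall_algHom (B : Type u) [CommRing B] [Algebra k B] [_root_.IsReduced B]
    [Algebra.FiniteType k B] (x : B) (hx : ∀ φ : B →ₐ[k] k, φ x = 0) : x = 0 := by
  have : IsJacobsonRing B := isJacobsonRing_of_finiteType (A := k)
  have hjac : Ideal.jacobson (⊥ : Ideal B) = ⊥ :=
    isJacobsonRing_iff.mp this ⊥ (fun y hy => by
      obtain ⟨n, hn⟩ := hy
      exact IsNilpotent.eq_zero ⟨n, hn⟩)
  have : x ∈ Ideal.jacobson (⊥ : Ideal B) := by
    rw [Ideal.jacobson, Ideal.mem_sInf]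
    rintro m ⟨-, hm⟩
    let _ : Field (B ⧸ m) := Ideal.Quotient.field m
    have : Module.Finite k (B ⧸ m) := finite_of_finite_type_of_isJacobsonRing k (B ⧸ m)
    have hbij : Function.Bijective (Algebra.ofId k (B ⧸ m)) :=
      IsAlgClosed.algebraMap_bijective_of_isIntegral
    have h := hx ((AlgEquiv.ofBijective _ hbij).symm.toAlgHom.comp (Ideal.Quotient.mkₐ k m))
    simpa [Ideal.Quotient.eq_zero_iff_mem] using h
  rw [hjac] at this
  exact this

theorem isReduced_tensorProduct (A B : Type u) [CommRing A] [Algebra k A] [_root_.IsReduced A]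
    [CommRing B] [Algebra k B] [_root_.IsReduced B] [Algebra.FiniteType k B] :
    _root_.IsReduced (A ⊗[k] B) := by
  classical
  let b := Module.Free.chooseBasis k A
  refine ⟨fun x hx => ?_⟩
  have h0 (φ : B →ₐ[k] k) : Algebra.TensorProduct.lift (AlgHom.id k A) ((Algebra.ofId k A).comp φ)
      (fun _ _ => Commute.all _ _) x = 0 := IsNilpotent.eq_zero (hx.map _)
  obtain ⟨c, rfl⟩ := TensorProduct.eq_repr_basis_left b x
  have hc : c = 0 := by
    ext i
    refine eq_zero_of_forall_algHom (k := k) B _ fun φ => ?_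
    have h := h0 φ
    rw [Finsupp.sum, map_sum] at h
    have h' : ∑ j ∈ c.support, φ (c j) • b j = 0 := by
      rw [← h]
      refine Finset.sum_congr rfl fun j _ => ?_
      simp [Algebra.smul_def, mul_comm, Algebra.ofId_apply]
    by_cases hi : i ∈ c.support
    · exact linearIndependent_iff'.mp b.linearIndependent _ _ h' i hi
    · rw [Finsupp.notMem_support_iff.mp hi, map_zero]
  subst hc
  simp

theorem isReduced_pullback_Spec {A B : CommRingCat.{u}} (f : Spec A ⟶ Spec (CommRingCat.of k))
    (g : Spec B ⟶ Spec (CommRingCat.of k)) [IsReduced (Spec A)] [IsReduced (Spec B)]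
    [LocallyOfFiniteType g] : IsReduced (Limits.pullback f g) := by
  obtain ⟨f, rfl⟩ := Spec.map_surjective f
  obtain ⟨g, rfl⟩ := Spec.map_surjective g
  algebraize [f.hom, g.hom]
  have : _root_.IsReduced A := (affine_isReduced_iff A).mp inferInstance
  have : _root_.IsReduced B := (affine_isReduced_iff B).mp inferInstance
  have : Algebra.FiniteType k B := RingHom.finiteType_algebraMap.mp
    ((HasRingHomProperty.Spec_iff (P := @LocallyOfFiniteType)).mp ‹LocallyOfFiniteType _›)
  have := isReduced_tensorProduct (k := k) A B
  exact isReduced_of_isOpenImmersion (pullbackSpecIso k A B).hom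

theorem isReduced_pullback {X Y : Scheme.{u}} (f : X ⟶ Spec (CommRingCat.of k))
    (g : Y ⟶ Spec (CommRingCat.of k)) [IsReduced X] [IsReduced Y] [LocallyOfFiniteType g] :
    IsReduced (Limits.pullback f g) := by
  let 𝒰 := Scheme.Pullback.openCoverOfLeftRight X.affineCover Y.affineCover f g
  have (i : 𝒰.I₀) : IsReduced (𝒰.X i) := by
    have h₁ : IsReduced (X.affineCover.X i.1) := inferInstance
    have h₂ : IsReduced (Y.affineCover.X i.2) := inferInstance
    have h₃ : LocallyOfFiniteType (Y.affineCover.f i.2 ≫ g) := inferInstance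
    exact @isReduced_pullback_Spec k _ _ _ _ (X.affineCover.f i.1 ≫ f) (Y.affineCover.f i.2 ≫ g)
      h₁ h₂ h₃
  exact IsReduced.of_openCover _ 𝒰

instance : (isVariety k).IsMonoidal where
  prop_unit :=
    { isReduced := inferInstanceAs (IsReduced (Spec (CommRingCat.of k)))
      isSeparated := inferInstanceAs (IsSeparated (𝟙 (Spec (CommRingCat.of k))))
      locallyOfFiniteType := inferInstanceAs (LocallyOfFiniteType (𝟙 (Spec (CommRingCat.of k))))
      quasiCompact := inferInstanceAs (QuasiCompact (𝟙 (Spec (CommRingCat.of k)))) }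
  prop_tensor X Y hX hY := by
    obtain ⟨_, _, _, _⟩ := hX
    obtain ⟨_, _, _, _⟩ := hY
    exact
      { isReduced := isReduced_pullback X.hom Y.hom
        isSeparated := by rw [Over.tensorObj_hom]; infer_instance
        locallyOfFiniteType := by rw [Over.tensorObj_hom]; infer_instance
        quasiCompact := by rw [Over.tensorObj_hom]; infer_instance }

end Product

/-! ### The Grothendieck ring of varieties -/

section GrothendieckRing

variable (k : Type u) [Field k] [IsAlgClosed k]

/-- The isomorphism classes of `k`-varieties. They form a commutative monoid under the product
over `k`, with the class of `Spec k` as unit. -/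
abbrev IsoClass : Type (u + 1) := Skeleton (Variety k)

/-- The free abelian group on the isomorphism classes of `k`-varieties, with the multiplication
that extends the product of varieties bilinearly. -/
abbrev FreeRing : Type (u + 1) := MonoidAlgebra ℤ (IsoClass k)

variable {k} in
/-- The generator of the free group given by a variety. -/
def gen (X : Variety k) : FreeRing k := MonoidAlgebra.of ℤ (IsoClass k) (toSkeleton X)

/-- The elements `[X] - [Y] - [X - Y]`, for `Y` closed in the variety `X`. The variety `X - Y` is
given by an open immersion `j : U ⟶ X` onto the complement of `Y`. -/
def scissorRelations : Set (FreeRing k) :=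
  {r | ∃ (X Y U : Variety k) (i : Y ⟶ X) (j : U ⟶ X),
    IsClosedImmersion i.hom.left ∧ IsOpenImmersion j.hom.left ∧
    Set.range j.hom.left = (Set.range i.hom.left)ᶜ ∧ r = gen X - gen Y - gen U}

theorem gen_tensor (X Y : Variety k) : gen (X ⊗ Y) = gen X * gen Y := by
  simp [gen, Skeleton.toSkeleton_tensorObj]

variable {k} in
theorem isPullback_whiskerLeft (Z : Variety k) {X Y : Variety k} (f : Y ⟶ X) :
    IsPullback (Limits.pullback.snd Z.obj.hom Y.obj.hom) (Z ◁ f).hom.left f.hom.left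
      (Limits.pullback.snd Z.obj.hom X.obj.hom) := by
  have hf : f.hom.left ≫ X.obj.hom = Y.obj.hom := Over.w f.hom
  have h₁ : (Z ◁ f).hom.left ≫ Limits.pullback.snd Z.obj.hom X.obj.hom =
      Limits.pullback.snd Z.obj.hom Y.obj.hom ≫ f.hom.left :=
    Over.whiskerLeft_left_snd (R := Z.obj) f.hom
  have h₂ : (Z ◁ f).hom.left ≫ Limits.pullback.fst Z.obj.hom X.obj.hom =
      Limits.pullback.fst Z.obj.hom Y.obj.hom :=
    Over.whiskerLeft_left_fst (R := Z.obj) f.hom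
  have h₃ : IsPullback ((Z ◁ f).hom.left ≫ Limits.pullback.fst Z.obj.hom X.obj.hom)
      (Limits.pullback.snd Z.obj.hom Y.obj.hom) Z.obj.hom (f.hom.left ≫ X.obj.hom) := by
    rw [h₂, hf]
    exact IsPullback.of_hasPullback Z.obj.hom Y.obj.hom
  exact (IsPullback.of_right h₃ h₁ (IsPullback.of_hasPullback Z.obj.hom X.obj.hom)).flip

variable {k} in
theorem range_whiskerLeft (Z : Variety k) {X Y : Variety k} (f : Y ⟶ X) :
    Set.range (Z ◁ f).hom.left =
      Limits.pullback.snd Z.obj.hom X.obj.hom ⁻¹' Set.range f.hom.left := by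
  have h := Scheme.image_preimage_eq_of_isPullback (isPullback_whiskerLeft Z f) Set.univ
  rw [Set.preimage_univ, Set.image_univ, Set.image_univ] at h
  exact h

theorem gen_mul_scissor (Z : Variety k) {r : FreeRing k} (hr : r ∈ scissorRelations k) :
    gen Z * r ∈ scissorRelations k := by
  obtain ⟨X, Y, U, i, j, hi, hj, hij, rfl⟩ := hr
  refine ⟨Z ⊗ X, Z ⊗ Y, Z ⊗ U, Z ◁ i, Z ◁ j, ?_, ?_, ?_, ?_⟩
  · exact MorphismProperty.of_isPullback (P := @IsClosedImmersion) (isPullback_whiskerLeft Z i) hi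
  · exact MorphismProperty.of_isPullback (P := @IsOpenImmersion) (isPullback_whiskerLeft Z j) hj
  · rw [range_whiskerLeft, range_whiskerLeft, hij, Set.preimage_compl]
  · simp only [gen_tensor]; ring

/-- The subgroup generated by the relations `[X] - [Y] - [X - Y]`. It is an ideal. -/
def scissorIdeal : Ideal (FreeRing k) where
  __ := AddSubgroup.closure (scissorRelations k)
  smul_mem' c x hx := by
    change c * x ∈ AddSubgroup.closure (scissorRelations k)
    change x ∈ AddSubgroup.closure (scissorRelations k) at hx
    induction c using MonoidAlgebra.induction_linear with
    | zero => simp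
    | add f g hf hg => rw [add_mul]; exact add_mem hf hg
    | single m n =>
      have hm : MonoidAlgebra.single m n = n • gen (k := k) ((fromSkeleton _).obj m) := by
        rw [gen, toSkeleton_fromSkeleton_obj]; simp
      rw [hm, smul_mul_assoc]
      refine AddSubgroup.zsmul_mem _ ?_ n
      induction hx using AddSubgroup.closure_induction with
      | mem x hx => exact AddSubgroup.subset_closure (gen_mul_scissor k _ hx)
      | zero => simp
      | add x y _ _ hx hy => rw [mul_add]; exact add_mem hx hy
      | neg x _ hx => rw [mul_neg]; exact neg_mem hx

/-- The Grothendieck ring `K₀(𝒱_k)` of varieties: the abelian group generated by the isomorphism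
classes of `k`-varieties subject to the relations `[X - Y] = [X] - [Y]` for `Y` closed in `X`,
with the multiplication induced by the product over `k`. -/
abbrev K0 : Type (u + 1) := FreeRing k ⧸ scissorIdeal k

variable {k} in
/-- The class `[X]` of a variety in `K₀(𝒱_k)`. -/
def K0.cls (X : Variety k) : K0 k := Ideal.Quotient.mk (scissorIdeal k) (gen X)

/-- `𝕃`, the class of the affine line `𝔸¹ = Spec k[T]`. -/
def K0.lefschetz : K0 k := K0.cls (Variety.ofAlgebra k (Polynomial k))

end GrothendieckRing

/-! ### The orbit space of a representation -/

section OrbitSpace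

variable {k : Type u} [Field k] {G : Type w} [Group G] {V : Type u} [AddCommGroup V] [Module k V]

/-- The coordinate ring `k[V] = Sym(V*)` of a finite dimensional vector space `V`, regarded as an
affine variety. -/
abbrev CoordRing (k V : Type u) [Field k] [AddCommGroup V] [Module k V] : Type u :=
  SymmetricAlgebra k (Module.Dual k V)

/-- The action of `g` on the coordinate ring: the algebra endomorphism of `Sym(V*)` extending the
action `ℓ ↦ ℓ ∘ ρ(g⁻¹)` on linear forms. -/
def coordAction (ρ : Representation k G V) (g : G) : CoordRing k V →ₐ[k] CoordRing k V :=
  SymmetricAlgebra.lift (SymmetricAlgebra.ι k (Module.Dual k V) ∘ₗ ρ.dual g)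

/-- The algebra `k[V]^G` of invariant functions. -/
def invariants (ρ : Representation k G V) : Subalgebra k (CoordRing k V) where
  carrier := {f | ∀ g : G, coordAction ρ g f = f}
  mul_mem' ha hb g := by rw [map_mul, ha g, hb g]
  add_mem' ha hb g := by rw [map_add, ha g, hb g]
  algebraMap_mem' r g := AlgHom.commutes _ r

instance [FiniteDimensional k V] : Algebra.FiniteType k (CoordRing k V) :=
  Algebra.FiniteType.equiv inferInstance
    (SymmetricAlgebra.equivMvPolynomial (Module.finBasis k (Module.Dual k V))).symm

instance (ρ : Representation k G V) : _root_.IsReduced (invariants ρ) :=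
  isReduced_of_injective (invariants ρ).val Subtype.val_injective

theorem coordAction_one (ρ : Representation k G V) : coordAction ρ 1 = AlgHom.id k _ := by
  apply SymmetricAlgebra.algHom_ext
  ext ℓ
  change coordAction ρ 1 (SymmetricAlgebra.ι k _ ℓ) = SymmetricAlgebra.ι k _ ℓ
  simp only [coordAction, SymmetricAlgebra.lift_ι_apply, LinearMap.comp_apply, map_one,
    Module.End.one_apply]

theorem coordAction_mul (ρ : Representation k G V) (g h : G) :
    coordAction ρ (g * h) = (coordAction ρ g).comp (coordAction ρ h) := by
  apply SymmetricAlgebra.algHom_ext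
  ext ℓ
  change coordAction ρ (g * h) (SymmetricAlgebra.ι k _ ℓ) =
    coordAction ρ g (coordAction ρ h (SymmetricAlgebra.ι k _ ℓ))
  simp only [coordAction, SymmetricAlgebra.lift_ι_apply, LinearMap.comp_apply, map_mul,
    Module.End.mul_apply]

instance finiteType_invariants [Finite G] [FiniteDimensional k V] (ρ : Representation k G V) :
    Algebra.FiniteType k (invariants ρ) := by
  let _ : MulSemiringAction G (CoordRing k V) :=
    { smul := fun g f => coordAction ρ g f
      one_smul := fun f => congr($(coordAction_one ρ) f)
      mul_smul := fun g h f => congr($(coordAction_mul ρ g h) f)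
      smul_zero := fun g => map_zero (coordAction ρ g)
      smul_add := fun g => map_add (coordAction ρ g)
      smul_one := fun g => map_one (coordAction ρ g)
      smul_mul := fun g => map_mul (coordAction ρ g) }
  have : SMulCommClass G (invariants ρ) (CoordRing k V) := ⟨fun g a b => by
    change coordAction ρ g (a.1 * b) = a.1 * coordAction ρ g b
    rw [map_mul, a.2 g]⟩
  have : Algebra.IsInvariant (invariants ρ) (CoordRing k V) G := ⟨fun b hb => ⟨⟨b, hb⟩, rfl⟩⟩
  have : Algebra.IsIntegral (invariants ρ) (CoordRing k V) := Algebra.IsInvariant.isIntegral _ _ G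
  have : Algebra.FiniteType (invariants ρ) (CoordRing k V) := .of_restrictScalars_finiteType k _ _
  have : Module.Finite (invariants ρ) (CoordRing k V) := Algebra.IsIntegral.finite
  exact ⟨fg_of_fg_of_fg k (invariants ρ) (CoordRing k V) Algebra.FiniteType.out Module.Finite.fg_top
    Subtype.val_injective⟩

/-- The orbit space `G\V = Spec k[V]^G` of a finite dimensional representation of a finite group,
as a variety. -/
def orbitSpace [Finite G] [FiniteDimensional k V] (ρ : Representation k G V) : Variety k :=
  Variety.ofAlgebra k (invariants ρ)

end OrbitSpace

end Motivic

end

noncomputable section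

namespace Motivic

/-! ### Classes of affine varieties -/

section Affine

variable {k : Type u} [Field k]

/-! An abelian `G` acts diagonally in a suitable basis of `V*`, so every monomial is an eigenvector
and `k[V]^G` is spanned by the monomials with exponent in a lattice `H ≤ ℤ^n`. The eigenvalues are
roots of unity of order dividing `N = |G|`, so `H` contains `N • ℤ^n`; nothing else about `H` is
used (`invariantsEquiv`).

The orbit space is then cut along its coordinate hyperplanes. For disjoint `S` and `T`, let the
coordinates in `S` be invertible, those in `T` arbitrary and all others zero. The locus `x_j = 0`
moves `j` out of `T`, and its complement, where `x_j ^ N` is inverted, moves `j` from `T` to `S`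
(`K0.cls_away`, `ker_restrictFace_le`, `isLocalization_away_coordPow`). When `T = ∅` the piece is a
split torus of dimension `|S|`, since the sublattice of `H` supported in `S` has full rank.
Induction on `T` gives the class `(𝕃 - 1) ^ |S| * 𝕃 ^ |T|` (`K0.cls_latticeCone`), and `S = ∅` with
`T` everything gives the theorem. -/

/-- The morphism of affine varieties given by a homomorphism of algebras. -/
def Variety.specMap {A B : Type u} [CommRing A] [Algebra k A] [_root_.IsReduced A]
    [Algebra.FiniteType k A] [CommRing B] [Algebra k B] [_root_.IsReduced B]
    [Algebra.FiniteType k B] (f : A →ₐ[k] B) :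
    Variety.ofAlgebra k B ⟶ Variety.ofAlgebra k A :=
  ObjectProperty.homMk (Over.homMk (Spec.map (CommRingCat.ofHom f.toRingHom)) (by
    change Spec.map _ ≫ Spec.map _ = Spec.map _
    rw [← Spec.map_comp, ← CommRingCat.ofHom_comp]
    congr 2
    exact f.comp_algebraMap))

variable [IsAlgClosed k]

theorem K0.cls_eq_of_iso {X Y : Variety k} (e : X ≅ Y) : K0.cls X = K0.cls Y := by
  simp only [K0.cls, gen, congr_toSkeleton_of_iso e]

theorem K0.cls_ofAlgebra_congr {A B : Type u} [CommRing A] [Algebra k A] [_root_.IsReduced A]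
    [Algebra.FiniteType k A] [CommRing B] [Algebra k B] [_root_.IsReduced B]
    [Algebra.FiniteType k B] (e : A ≃ₐ[k] B) :
    K0.cls (Variety.ofAlgebra k A) = K0.cls (Variety.ofAlgebra k B) := by
  refine K0.cls_eq_of_iso ((isVariety k).isoMk (Over.isoMk
    (Scheme.Spec.mapIso e.toRingEquiv.toCommRingCatIso.op).symm ?_))
  change Spec.map _ ≫ Spec.map _ = Spec.map _
  rw [← Spec.map_comp]
  congr 1
  ext x
  exact e.symm.commutes x

theorem K0.cls_tensor (X Y : Variety k) : K0.cls (X ⊗ Y) = K0.cls X * K0.cls Y := by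
  simp only [K0.cls, gen_tensor, map_mul]

theorem K0.cls_tensorUnit : K0.cls (𝟙_ (Variety k)) = 1 := by
  have : gen (𝟙_ (Variety k)) = 1 := by
    rw [gen, show toSkeleton (𝟙_ (Variety k)) = 1 from rfl, map_one]
  rw [K0.cls, this, map_one]

theorem K0.cls_ofAlgebra_self : K0.cls (Variety.ofAlgebra k k) = 1 := by
  have h : Spec.map (CommRingCat.ofHom (algebraMap k k)) = 𝟙 (Spec (CommRingCat.of k)) :=
    Spec.map_id _
  have e : (Variety.ofAlgebra k k).obj = Over.mk (𝟙 (Spec (CommRingCat.of k))) :=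
    congrArg Over.mk h
  rw [← K0.cls_tensorUnit]
  exact K0.cls_eq_of_iso ((isVariety k).isoMk (eqToIso e))

theorem K0.cls_tensorProduct {A B C : Type u} [CommRing A] [Algebra k A] [_root_.IsReduced A]
    [Algebra.FiniteType k A] [CommRing B] [Algebra k B] [_root_.IsReduced B]
    [Algebra.FiniteType k B] [CommRing C] [Algebra k C] [_root_.IsReduced C]
    [Algebra.FiniteType k C] (e : A ⊗[k] B ≃ₐ[k] C) :
    K0.cls (Variety.ofAlgebra k C) =
      K0.cls (Variety.ofAlgebra k A) * K0.cls (Variety.ofAlgebra k B) := by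
  have : _root_.IsReduced (A ⊗[k] B) := isReduced_of_injective e e.injective
  have : Algebra.FiniteType k (A ⊗[k] B) := .equiv inferInstance e.symm
  rw [← K0.cls_ofAlgebra_congr e, ← K0.cls_tensor]
  refine (K0.cls_eq_of_iso ((isVariety k).isoMk (Over.isoMk (pullbackSpecIso k A B) ?_))).symm
  change _ ≫ Spec.map _ = _
  exact pullbackSpecIso_hom_base k A B

theorem K0.cls_scissor {X Y U : Variety k} (i : Y ⟶ X) (j : U ⟶ X)
    (hi : IsClosedImmersion i.hom.left) (hj : IsOpenImmersion j.hom.left)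
    (hij : Set.range j.hom.left = (Set.range i.hom.left)ᶜ) :
    K0.cls X = K0.cls Y + K0.cls U := by
  have h : gen X - gen Y - gen U ∈ scissorIdeal k :=
    AddSubgroup.subset_closure ⟨X, Y, U, i, j, hi, hj, hij, rfl⟩
  have h' := Ideal.Quotient.eq_zero_iff_mem.mpr h
  rw [map_sub, map_sub, sub_sub, sub_eq_zero] at h'
  exact h'

/-- If `C` is the localization of `A` at `x`, and `B` is a quotient of `A` with the zero locus
of `x` as its spectrum, then `[Spec A] = [Spec B] + [Spec C]`. -/
theorem K0.cls_away {A B C : Type u} [CommRing A] [Algebra k A] [_root_.IsReduced A]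
    [Algebra.FiniteType k A] [CommRing B] [Algebra k B] [_root_.IsReduced B]
    [Algebra.FiniteType k B] [CommRing C] [Algebra k C] [_root_.IsReduced C]
    [Algebra.FiniteType k C] (x : A) (f : A →ₐ[k] B) (hf : Function.Surjective f) (hx : f x = 0)
    (hker : ∀ p : Ideal A, p.IsPrime → x ∈ p → RingHom.ker f ≤ p)
    [Algebra A C] [IsScalarTower k A C] [IsLocalization.Away x C] :
    K0.cls (Variety.ofAlgebra k A) =
      K0.cls (Variety.ofAlgebra k B) + K0.cls (Variety.ofAlgebra k C) := by
  refine K0.cls_scissor (Variety.specMap f) (Variety.specMap (IsScalarTower.toAlgHom k A C))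
    (IsClosedImmersion.spec_of_surjective _ hf) ?_ ?_
  · exact IsOpenImmersion.of_isLocalization x
  · change Set.range (PrimeSpectrum.comap (algebraMap A C)) =
      (Set.range (PrimeSpectrum.comap f.toRingHom))ᶜ
    rw [PrimeSpectrum.localization_away_comap_range C x,
      range_comap_of_surjective _ _ hf]
    ext p
    simp only [SetLike.mem_coe, PrimeSpectrum.mem_basicOpen, Set.mem_compl_iff,
      PrimeSpectrum.mem_zeroLocus, not_iff_not]
    -- Only the zero loci of `x` and of `ker f` have to agree: `x` need not generate the kernel, and
    -- `x_j ^ N` in general does not.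
    exact ⟨fun h => hker p.asIdeal p.isPrime h, fun h => h hx⟩

end Affine

open AddMonoidAlgebra

/-! ### Classes of split tori -/

section Torus

variable (k : Type u) [Field k]

instance isReduced_addMonoidAlgebra_lattice {ι : Type} (M : AddSubmonoid (ι → ℤ)) :
    _root_.IsReduced (AddMonoidAlgebra k M) :=
  isReduced_of_injective (mapDomainAlgHom k k M.subtype)
    (mapDomain_injective Subtype.val_injective)

instance finiteType_addMonoidAlgebra_of_module_finite (M : Type) [AddCommGroup M]
    [Module.Finite ℤ M] : Algebra.FiniteType k (AddMonoidAlgebra k M) :=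
  have : AddGroup.FG M := Module.Finite.iff_addGroup_fg.mp inferInstance
  have : AddMonoid.FG M := AddGroup.fg_iff_addMonoid_fg.mp inferInstance
  finiteType_of_fg k M

variable [IsAlgClosed k]

/-- The punctured line is the affine line minus the origin. -/
theorem K0.cls_laurentPolynomial :
    K0.cls (Variety.ofAlgebra k (AddMonoidAlgebra k ℤ)) = K0.lefschetz k - 1 := by
  let _ : Algebra (Polynomial k) (AddMonoidAlgebra k ℤ) :=
    inferInstanceAs (Algebra (Polynomial k) (LaurentPolynomial k))
  have : IsScalarTower k (Polynomial k) (AddMonoidAlgebra k ℤ) :=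
    .of_algebraMap_eq fun a => (Polynomial.toLaurent_C a).symm
  have : IsLocalization.Away (Polynomial.X : Polynomial k) (AddMonoidAlgebra k ℤ) :=
    LaurentPolynomial.isLocalization
  rw [K0.lefschetz, K0.cls_away (C := AddMonoidAlgebra k ℤ) (Polynomial.X : Polynomial k)
    (Polynomial.aeval (0 : k)) (fun a => ⟨Polynomial.C a, by simp⟩) (by simp)
    (fun p _ hp f hf => ?_),
    K0.cls_ofAlgebra_self, add_sub_cancel_left]
  have : (Polynomial.X : Polynomial k) ∣ f := by
    rw [Polynomial.X_dvd_iff, Polynomial.coeff_zero_eq_aeval_zero]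
    exact hf
  exact Ideal.mem_of_dvd p this hp

theorem K0.cls_torus (r : ℕ) :
    K0.cls (Variety.ofAlgebra k (AddMonoidAlgebra k (Fin r → ℤ))) = (K0.lefschetz k - 1) ^ r := by
  induction r with
  | zero => 
    let e : AddMonoidAlgebra k (Fin 0 → ℤ) ≃ₐ[k] k := uniqueAlgEquiv k (Fin 0 → ℤ)
    rw [K0.cls_ofAlgebra_congr e, K0.cls_ofAlgebra_self, pow_zero]
  | succ r ih =>
    let e₁ : (ℤ × (Fin r → ℤ)) ≃+ (Fin (r + 1) → ℤ) :=
      (Fin.consLinearEquiv ℤ (fun _ : Fin (r + 1) => ℤ)).toAddEquiv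
    -- With `A = k[ℤ^r]`: `A ⊗ k[ℤ] ≃ A[ℤ] ≃ k[ℤ × ℤ^r] ≃ k[ℤ^(r+1)]`.
    let e₂ : AddMonoidAlgebra k (Fin r → ℤ) ⊗[k] AddMonoidAlgebra k ℤ ≃ₐ[k]
        AddMonoidAlgebra k (Fin (r + 1) → ℤ) :=
      ((scalarTensorEquiv (M := ℤ) k (AddMonoidAlgebra k (Fin r → ℤ))).restrictScalars k).trans
        ((curryAlgEquiv k).symm.trans (domCongr k k e₁))
    rw [K0.cls_tensorProduct e₂, ih, K0.cls_laurentPolynomial, pow_succ]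

theorem K0.cls_addMonoidAlgebra_free (M : Type) [AddCommGroup M] [Module.Free ℤ M]
    [Module.Finite ℤ M] [_root_.IsReduced (AddMonoidAlgebra k M)] :
    K0.cls (Variety.ofAlgebra k (AddMonoidAlgebra k M)) =
      (K0.lefschetz k - 1) ^ Module.finrank ℤ M := by
  rw [← K0.cls_torus]
  exact K0.cls_ofAlgebra_congr (domCongr k k (Module.finBasis ℤ M).equivFun.toAddEquiv)

end Torus

/-! ### Toric quotients -/

section Cone

variable {ι : Type}

/-- The vectors of a lattice `H ≤ ℤ ^ ι` with support in `S ∪ T` and nonnegative coordinates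
outside `S`. -/
def latticeCone (H : AddSubgroup (ι → ℤ)) (S T : Finset ι) : AddSubmonoid (ι → ℤ) where
  carrier := {a | a ∈ H ∧ (∀ i, i ∉ S → 0 ≤ a i) ∧ ∀ i, i ∉ S → i ∉ T → a i = 0}
  zero_mem' := ⟨H.zero_mem, fun _ _ => le_rfl, fun _ _ _ => rfl⟩
  add_mem' ha hb := ⟨H.add_mem ha.1 hb.1, fun i hi => add_nonneg (ha.2.1 i hi) (hb.2.1 i hi),
    fun i hS hT => by rw [Pi.add_apply, ha.2.2 i hS hT, hb.2.2 i hS hT, add_zero]⟩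

/-- The vectors of a lattice `H ≤ ℤ ^ ι` with support in `S`. -/
def latticeSupported (H : AddSubgroup (ι → ℤ)) (S : Finset ι) : AddSubgroup (ι → ℤ) where
  carrier := {a | a ∈ H ∧ ∀ i, i ∉ S → a i = 0}
  zero_mem' := ⟨H.zero_mem, fun _ _ => rfl⟩
  add_mem' ha hb := ⟨H.add_mem ha.1 hb.1,
    fun i hS => by rw [Pi.add_apply, ha.2 i hS, hb.2 i hS, add_zero]⟩
  neg_mem' ha := ⟨H.neg_mem ha.1, fun i hS => by rw [Pi.neg_apply, ha.2 i hS, neg_zero]⟩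

instance [Finite ι] (H : AddSubgroup (ι → ℤ)) (S : Finset ι) :
    Module.Finite ℤ (latticeSupported H S) :=
  inferInstanceAs (Module.Finite ℤ (AddSubgroup.toIntSubmodule (latticeSupported H S)))

instance [Finite ι] (H : AddSubgroup (ι → ℤ)) (S : Finset ι) :
    Module.Free ℤ (latticeSupported H S) :=
  inferInstanceAs (Module.Free ℤ (AddSubgroup.toIntSubmodule (latticeSupported H S)))

/-- The lattice lies between `N • ℤ^S` and `ℤ^S`; each inclusion bounds the rank on one side. -/
theorem finrank_latticeSupported [Finite ι] {H : AddSubgroup (ι → ℤ)} {N : ℕ} (hN : N ≠ 0)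
    (hH : ∀ a, N • a ∈ H) (S : Finset ι) : Module.finrank ℤ (latticeSupported H S) = S.card := by
  classical
  apply le_antisymm
  · let f : latticeSupported H S →ₗ[ℤ] (S → ℤ) :=
      { toFun := fun a i => a.1 i
        map_add' := fun _ _ => rfl
        map_smul' := fun _ _ => rfl }
    have hf : Function.Injective f := fun a b h => Subtype.ext (funext fun i => by
      by_cases hi : i ∈ S
      · exact congrFun h ⟨i, hi⟩
      · rw [a.2.2 i hi, b.2.2 i hi])
    simpa using LinearMap.finrank_le_finrank_of_injective hf
  · let e (a : S → ℤ) : ι → ℤ := fun i => if hi : i ∈ S then a ⟨i, hi⟩ else 0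
    let f : (S → ℤ) →ₗ[ℤ] latticeSupported H S :=
      { toFun := fun a => ⟨N • e a, hH _, fun i hi => by simp [e, hi]⟩
        map_add' := fun a b => Subtype.ext (funext fun i => by
          by_cases hi : i ∈ S <;> simp [e, hi, mul_add])
        map_smul' := fun c a => Subtype.ext (funext fun i => by
          by_cases hi : i ∈ S <;> simp [e, hi, mul_left_comm]) }
    have hf : Function.Injective f := fun a b h => funext fun i => by
      have := congrFun (congrArg Subtype.val h) i
      simpa [f, e, hN] using this
    simpa using LinearMap.finrank_le_finrank_of_injective hf

/-- Without nonnegativity constraints, a lattice cone is a lattice. -/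
def latticeConeEmptyEquiv (H : AddSubgroup (ι → ℤ)) (S : Finset ι) :
    latticeCone H S ∅ ≃+ latticeSupported H S where
  toFun a := ⟨a.1, a.2.1, fun i hi => a.2.2.2 i hi (Finset.notMem_empty i)⟩
  invFun a := ⟨a.1, a.2.1, fun i hi => (a.2.2 i hi).ge, fun i hi _ => a.2.2 i hi⟩
  left_inv _ := rfl
  right_inv _ := rfl
  map_add' _ _ := rfl

variable (k : Type u) [Field k]

/-! ### Cutting a cone along one coordinate -/

section Face

variable [DecidableEq ι] (H : AddSubgroup (ι → ℤ)) (S T : Finset ι) (j : ι)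

theorem latticeCone_le_insert_right : latticeCone H S T ≤ latticeCone H S (insert j T) :=
  fun _ ha => ⟨ha.1, ha.2.1, fun i hS hT => ha.2.2 i hS fun h => hT (Finset.mem_insert_of_mem h)⟩

theorem latticeCone_insert_right_le :
    latticeCone H S (insert j T) ≤ latticeCone H (insert j S) T :=
  fun _ ha => ⟨ha.1, fun i hi => ha.2.1 i fun h => hi (Finset.mem_insert_of_mem h),
    fun i hS hT => ha.2.2 i (fun h => hS (Finset.mem_insert_of_mem h)) fun h =>
      (Finset.mem_insert.mp h).elim (fun h => hS (h ▸ Finset.mem_insert_self _ _)) hT⟩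

variable {H S T j}

theorem mem_latticeCone_of_eq_zero {a : ι → ℤ} (ha : a ∈ latticeCone H S (insert j T))
    (h : a j = 0) : a ∈ latticeCone H S T :=
  ⟨ha.1, ha.2.1, fun i hS hT => by
    by_cases hij : i = j
    · rw [hij, h]
    · exact ha.2.2 i hS (by simp [hij, hT])⟩

variable (H S T j) in
/-- The restriction of functions to the locus where the `j`-th coordinate vanishes. -/
def restrictFace (hj : j ∉ S) : AddMonoidAlgebra k (latticeCone H S (insert j T)) →ₐ[k]
    AddMonoidAlgebra k (latticeCone H S T) :=
  lift k _ _
    { toFun := fun a => if h : a.toAdd.1 j = 0 then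
        single ⟨a.toAdd.1, mem_latticeCone_of_eq_zero a.toAdd.2 h⟩ 1 else 0
      map_one' := dif_pos rfl
      map_mul' := fun a b => by
        -- Since `j ∉ S`, both `j`-th coordinates are nonnegative, so their sum vanishes only if
        -- both do.
        have ha := a.toAdd.2.2.1 j hj
        have hb := b.toAdd.2.2.1 j hj
        have hab : (a * b).toAdd.1 j = a.toAdd.1 j + b.toAdd.1 j := rfl
        by_cases h : a.toAdd.1 j = 0
        · by_cases h' : b.toAdd.1 j = 0
          · rw [dif_pos h, dif_pos h', dif_pos (by omega), single_mul_single, one_mul]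
            rfl
          · rw [dif_neg h', dif_neg (by omega), mul_zero]
        · rw [dif_neg h, dif_neg (by omega), zero_mul] }

theorem restrictFace_single_of_eq_zero (hj : j ∉ S) (a : latticeCone H S (insert j T)) (c : k)
    (h : a.1 j = 0) : restrictFace k H S T j hj (single a c) =
      single ⟨a.1, mem_latticeCone_of_eq_zero a.2 h⟩ c := by
  rw [restrictFace, lift_single]
  refine (congrArg (c • ·) (dif_pos h)).trans ?_
  rw [smul_single, smul_eq_mul, mul_one]
  rfl

theorem restrictFace_single_of_ne_zero (hj : j ∉ S) (a : latticeCone H S (insert j T)) (c : k)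
    (h : a.1 j ≠ 0) : restrictFace k H S T j hj (single a c) = 0 := by
  rw [restrictFace, lift_single]
  exact (congrArg (c • ·) (dif_neg h)).trans (smul_zero c)

theorem restrictFace_single_inclusion (hj : j ∉ S) (hT : j ∉ T) (a : latticeCone H S T) (c : k) :
    restrictFace k H S T j hj
      (single (AddSubmonoid.inclusion (latticeCone_le_insert_right H S T j) a) c) = single a c :=
  restrictFace_single_of_eq_zero k hj _ c (a.2.2.2 j hj hT)

theorem restrictFace_surjective (hj : j ∉ S) (hT : j ∉ T) :
    Function.Surjective (restrictFace k H S T j hj) := fun f => by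
  induction f using induction_linear with
  | zero => exact ⟨0, map_zero _⟩
  | add f g hf hg =>
    obtain ⟨f, rfl⟩ := hf
    obtain ⟨g, rfl⟩ := hg
    exact ⟨f + g, map_add _ _ _⟩
  | single a c => exact ⟨_, restrictFace_single_inclusion k hj hT a c⟩

/-- The monomial `x_j ^ N`, for `N` with `N • ℤ ^ ι ≤ H`. -/
def coordPow {N : ℕ} (hH : ∀ a, N • a ∈ H) (S T : Finset ι) (j : ι) :
    latticeCone H S (insert j T) :=
  ⟨N • Pi.single j 1, hH _,
    fun i _ => by
      by_cases h : i = j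
      · subst h; simp
      · simp [h],
    fun i _ hT => by
      have : i ≠ j := fun h => hT (h ▸ Finset.mem_insert_self _ _)
      simp [this]⟩

theorem coordPow_apply_self {N : ℕ} (hH : ∀ a, N • a ∈ H) :
    (coordPow hH S T j).1 j = N := by
  simp [coordPow]

theorem coordPow_apply_of_ne {N : ℕ} (hH : ∀ a, N • a ∈ H) {i : ι} (h : i ≠ j) :
    (coordPow hH S T j).1 i = 0 := by
  simp [coordPow, h]

/-- The vector `a - e_j` may leave `H`, but `N • (a - e_j)` does not. So the `N`-th power of the
monomial is a multiple of `x_j ^ N`, and primality of `p` removes the power. -/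
theorem single_mem_of_coordPow_mem {N : ℕ} (hH : ∀ a, N • a ∈ H) (hj : j ∉ S)
    {p : Ideal (AddMonoidAlgebra k (latticeCone H S (insert j T)))} (hp : p.IsPrime)
    (hx : single (coordPow hH S T j) 1 ∈ p) (a : latticeCone H S (insert j T)) (c : k)
    (ha : a.1 j ≠ 0) : single a c ∈ p := by
  have ha' : 0 < a.1 j := lt_of_le_of_ne (a.2.2.1 j hj) ha.symm
  let b : latticeCone H S (insert j T) := ⟨N • (a.1 - Pi.single j 1), hH _,
    fun i hi => by
      by_cases h : i = j
      · subst h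
        simp only [Pi.smul_apply, Pi.sub_apply, Pi.single_eq_same]
        exact smul_nonneg N.zero_le (by omega)
      · simpa [h] using mul_nonneg (Int.natCast_nonneg N) (a.2.2.1 i hi),
    fun i hS hT => by
      have : i ≠ j := fun h => hT (h ▸ Finset.mem_insert_self _ _)
      simp [this, a.2.2.2 i hS hT]⟩
  have hab : N • a = b + coordPow hH S T j := Subtype.ext (by
    change N • a.1 = N • (a.1 - Pi.single j 1) + N • Pi.single j 1
    rw [smul_sub, sub_add_cancel])
  refine hp.mem_of_pow_mem N ?_
  rw [single_pow, hab, ← mul_one (c ^ N), ← single_mul_single]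
  exact p.mul_mem_left _ hx

/-- Restricting to the face and including back by `s` keeps exactly the monomials with `a j = 0`.
The difference from `f` consists of monomials already known to lie in `p`, and it is `f` itself when
`f` restricts to zero. -/
theorem ker_restrictFace_le {N : ℕ} (hH : ∀ a, N • a ∈ H) (hj : j ∉ S)
    (p : Ideal (AddMonoidAlgebra k (latticeCone H S (insert j T)))) (hp : p.IsPrime)
    (hx : single (coordPow hH S T j) 1 ∈ p) : RingHom.ker (restrictFace k H S T j hj) ≤ p := by
  let s := mapDomainAlgHom k k (AddSubmonoid.inclusion (latticeCone_le_insert_right H S T j))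
  have key (f) : f - s (restrictFace k H S T j hj f) ∈ p := by
    induction f using induction_linear with
    | zero => simp
    | add f g hf hg =>
      rw [map_add, map_add, add_sub_add_comm]
      exact p.add_mem hf hg
    | single a c =>
      by_cases h : a.1 j = 0
      · have : s (single ⟨a.1, mem_latticeCone_of_eq_zero a.2 h⟩ c) = single a c :=
          mapDomain_single
        rw [restrictFace_single_of_eq_zero k hj a c h, this, sub_self]
        exact p.zero_mem
      · rw [restrictFace_single_of_ne_zero k hj a c h, map_zero, sub_zero]
        exact single_mem_of_coordPow_mem k hH hj hp hx a c h
  intro f hf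
  have := key f
  rwa [show restrictFace k H S T j hj f = 0 from hf, map_zero, sub_zero] at this

variable (H S T j) in
/-- Functions on the locus where the `j`-th coordinate does not vanish, as an algebra over the
functions on the whole space. -/
abbrev algebraInsert : Algebra (AddMonoidAlgebra k (latticeCone H S (insert j T)))
    (AddMonoidAlgebra k (latticeCone H (insert j S) T)) :=
  (mapDomainAlgHom k k
    (AddSubmonoid.inclusion (latticeCone_insert_right_le H S T j))).toRingHom.toAlgebra

/-- Adding a large multiple of `N • e_j` moves any vector of the larger cone into the smaller one.
The map of algebras is injective, so equality needs no extra power. -/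
theorem isLocalization_away_coordPow {N : ℕ} (hN : N ≠ 0) (hH : ∀ a, N • a ∈ H) (hj : j ∉ S) :
    let _ := algebraInsert k H S T j
    IsLocalization.Away (single (coordPow hH S T j) (1 : k))
      (AddMonoidAlgebra k (latticeCone H (insert j S) T)) := by
  intro _
  let x : latticeCone H (insert j S) T :=
    AddSubmonoid.inclusion (latticeCone_insert_right_le H S T j) (coordPow hH S T j)
  have hxj : x.1 j = N := coordPow_apply_self (S := S) (T := T) hH
  have hx {i : ι} (h : i ≠ j) : x.1 i = 0 := coordPow_apply_of_ne (S := S) (T := T) hH h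
  have hsingle (a) (c : k) : algebraMap (AddMonoidAlgebra k (latticeCone H S (insert j T)))
      (AddMonoidAlgebra k (latticeCone H (insert j S) T)) (single a c) =
        single (AddSubmonoid.inclusion (latticeCone_insert_right_le H S T j) a) c :=
    mapDomain_single
  have hinj : Function.Injective (algebraMap (AddMonoidAlgebra k (latticeCone H S (insert j T)))
      (AddMonoidAlgebra k (latticeCone H (insert j S) T))) :=
    mapDomain_injective (AddSubmonoid.inclusion_injective _)
  refine IsLocalization.Away.mk _ ?_ (fun f => ?_) (fun f g h => ⟨0, by rw [hinj h]⟩)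
  -- The inverse monomial is allowed because the only nonzero coordinate of `x` is the `j`-th, now
  -- unconstrained in sign.
  · let y : latticeCone H (insert j S) T := ⟨-x.1, H.neg_mem x.2.1,
      fun i hi => by
        have : i ≠ j := fun h => hi (h ▸ Finset.mem_insert_self _ _)
        exact (neg_eq_zero.mpr (hx this)).ge,
      fun i hS hT => neg_eq_zero.mpr (x.2.2.2 i hS hT)⟩
    have hxy : x + y = 0 := Subtype.ext (add_neg_cancel x.1)
    rw [hsingle]
    exact IsUnit.of_mul_eq_one (single y 1) (by
      rw [single_mul_single, hxy, one_mul]; rfl)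
  · induction f using induction_linear with
    | zero => exact ⟨0, 0, by simp⟩
    | add f g hf hg =>
      obtain ⟨m, a, ha⟩ := hf
      obtain ⟨n, b, hb⟩ := hg
      refine ⟨m + n, a * single (coordPow hH S T j) 1 ^ n + b * single (coordPow hH S T j) 1 ^ m, ?_⟩
      rw [map_add, map_mul, map_mul, ← ha, ← hb, map_pow, map_pow]
      ring
    | single a c =>
      -- This `n` suffices: `a j + n * N ≥ a j + n ≥ 0`, because `N ≥ 1`.
      let n := (a.1 j).natAbs
      let b : latticeCone H S (insert j T) := ⟨a.1 + n • x.1, H.add_mem a.2.1 (H.nsmul_mem x.2.1 n),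
        fun i hi => by
          by_cases h : i = j
          · subst h
            have h₂ : (n : ℤ) * 1 ≤ n * N := by gcongr; omega
            have h₃ : -(n : ℤ) ≤ a.1 i := by omega
            change 0 ≤ a.1 i + n • x.1 i
            rw [hxj, nsmul_eq_mul]
            linarith
          · have h₂ := a.2.2.1 i (by simp [h, hi])
            simpa [hx h] using h₂,
        fun i hS hT => by
          rw [Finset.mem_insert, not_or] at hT
          have h₂ := a.2.2.2 i (by simp [hT.1, hS]) hT.2
          rw [Pi.add_apply, Pi.smul_apply, hx hT.1, h₂, smul_zero, add_zero]⟩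
      refine ⟨n, single b c, ?_⟩
      rw [hsingle, hsingle, single_pow, single_mul_single, one_pow, mul_one]
      rfl

end Face

variable [IsAlgClosed k]

/-- The induction on `T` uses its hypothesis for both `S` and `insert j S`, so `S` stays general.
Finite generation is assumed only for the initial algebra: it passes to the quotient and to the
localization, so no separate finiteness argument for cones is needed. -/
theorem K0.cls_latticeCone [Finite ι] {H : AddSubgroup (ι → ℤ)} {N : ℕ} (hN : N ≠ 0)
    (hH : ∀ a, N • a ∈ H) (T : Finset ι) :
    ∀ (S : Finset ι) [Algebra.FiniteType k (AddMonoidAlgebra k (latticeCone H S T))],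
      Disjoint S T → K0.cls (Variety.ofAlgebra k (AddMonoidAlgebra k (latticeCone H S T))) =
        (K0.lefschetz k - 1) ^ S.card * K0.lefschetz k ^ T.card := by
  classical
  induction T using Finset.induction_on with
  | empty =>
    intro S _ _
    have : _root_.IsReduced (AddMonoidAlgebra k (latticeSupported H S)) :=
      isReduced_addMonoidAlgebra_lattice k (latticeSupported H S).toAddSubmonoid
    rw [K0.cls_ofAlgebra_congr (domCongr k k (latticeConeEmptyEquiv H S)),
      K0.cls_addMonoidAlgebra_free, finrank_latticeSupported hN hH, Finset.card_empty, pow_zero,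
      mul_one]
  | insert j T hT ih =>
    intro S _ hST
    rw [Finset.disjoint_insert_right] at hST
    have hj := hST.1
    let _ := algebraInsert k H S T j
    have : IsScalarTower k (AddMonoidAlgebra k (latticeCone H S (insert j T)))
        (AddMonoidAlgebra k (latticeCone H (insert j S) T)) :=
      .of_algebraMap_eq fun a => (AlgHom.commutes (mapDomainAlgHom k k _) a).symm
    have := isLocalization_away_coordPow (S := S) (T := T) k hN hH hj
    have : Algebra.FiniteType k (AddMonoidAlgebra k (latticeCone H S T)) :=
      .of_surjective _ (restrictFace_surjective k hj hT)
    have : Algebra.FiniteType (AddMonoidAlgebra k (latticeCone H S (insert j T)))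
        (AddMonoidAlgebra k (latticeCone H (insert j S) T)) :=
      IsLocalization.finiteType_of_monoid_fg (.powers (single (coordPow hH S T j) 1)) _
    have : Algebra.FiniteType k (AddMonoidAlgebra k (latticeCone H (insert j S) T)) :=
      .trans (S := AddMonoidAlgebra k (latticeCone H S (insert j T))) inferInstance inferInstance
    rw [K0.cls_away (C := AddMonoidAlgebra k (latticeCone H (insert j S) T))
      (single (coordPow hH S T j) (1 : k)) (restrictFace k H S T j hj)
      (restrictFace_surjective k hj hT)
      (restrictFace_single_of_ne_zero k hj _ _ (by
        rw [coordPow_apply_self]; exact_mod_cast hN))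
      (ker_restrictFace_le k hH hj), ih S hST.2,
      ih (insert j S) (Finset.disjoint_insert_left.mpr ⟨hT, hST.2⟩),
      Finset.card_insert_of_notMem hj, Finset.card_insert_of_notMem hT]
    -- `(𝕃 - 1)^s 𝕃^t + (𝕃 - 1)^(s+1) 𝕃^t = (𝕃 - 1)^s 𝕃^(t+1)`.
    ring

end Cone

/-! ### Diagonal actions -/

section Diagonal

/-- A representation of a finite abelian group over an algebraically closed field of
characteristic zero is diagonalizable. -/
theorem exists_basis_forall_smul {k : Type u} [Field k] [IsAlgClosed k] [CharZero k]
    {G : Type w} [CommGroup G] [Finite G] {W : Type u} [AddCommGroup W] [Module k W]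
    [FiniteDimensional k W] (σ : Representation k G W) {n : ℕ} (hn : Module.finrank k W = n) :
    ∃ (b : Module.Basis (Fin n) k W) (c : Fin n → G → kˣ),
      (∀ i g, σ g (b i) = (c i g : k) • b i) ∧ ∀ i g, c i g ^ Nat.card G = 1 := by
  have hpow (g : G) : σ g ^ Nat.card G = 1 := by rw [← map_pow, pow_card_eq_one', map_one]
  have hss (g : G) : Module.End.IsFinitelySemisimple (σ g) := by
    rw [Module.End.isFinitelySemisimple_iff_isSemisimple]
    -- In characteristic zero `X ^ |G| - 1` is separable, and it annihilates `σ g`.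
    refine Module.End.isSemisimple_of_squarefree_aeval_eq_zero
      (p := Polynomial.X ^ Nat.card G - 1) ?_ (by simp [hpow])
    exact (Polynomial.separable_X_pow_sub_C (1 : k) (Nat.cast_ne_zero.mpr Nat.card_pos.ne')
      one_ne_zero).squarefree
  -- The `σ g` commute, so their generalized eigenspaces decompose `W` jointly; semisimplicity then
  -- makes these true eigenspaces.
  have htop : ⨆ χ : G → k, ⨅ g, Module.End.maxGenEigenspace (σ g) (χ g) = ⊤ :=
    Module.End.iSup_iInf_maxGenEigenspace_eq_top_of_iSup_maxGenEigenspace_eq_top_of_commute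
      (fun g => σ g)
      (fun g h _ => by
        change σ g * σ h = σ h * σ g
        rw [← map_mul, mul_comm, map_mul])
      fun g => Module.End.iSup_maxGenEigenspace_eq_top (σ g)
  simp only [fun g => (hss g).maxGenEigenspace_eq_eigenspace] at htop
  let s : Set W := {v | ∃ χ : G → k, ∀ g, σ g v = χ g • v}
  have hs : ⊤ ≤ Submodule.span k s := by
    rw [← htop]
    refine iSup_le fun χ v hv => Submodule.subset_span ⟨χ, fun g => ?_⟩
    exact Module.End.mem_eigenspace_iff.mp ((Submodule.mem_iInf _).mp hv g)
  let b₀ := Module.Basis.ofSpan hs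
  let b := b₀.reindex (Fintype.equivFinOfCardEq (by
    rw [← Module.finrank_eq_card_basis b₀, hn]))
  have hb (i) : b i ∈ s := by
    rw [Module.Basis.reindex_apply]
    exact Module.Basis.ofSpan_subset hs ⟨_, rfl⟩
  choose χ hχ using hb
  -- Eigenvalues are roots of unity because `b i ≠ 0`; this also makes them units, as negative
  -- exponents require.
  have hχpow (i g) : χ i g ^ Nat.card G = 1 := by
    have h (m : ℕ) : (σ g ^ m) (b i) = χ i g ^ m • b i := by
      induction m with
      | zero => simp
      | succ m ih => rw [pow_succ', Module.End.mul_apply, ih, map_smul, hχ, smul_smul, pow_succ]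
    have := h (Nat.card G)
    rw [hpow, Module.End.one_apply] at this
    exact (smul_left_injective k (b.ne_zero i) ((one_smul k _).trans this)).symm
  refine ⟨b, fun i g => Units.ofPowEqOne _ _ (hχpow i g) Nat.card_pos.ne', fun i g => hχ i g,
    fun i g => Units.pow_ofPowEqOne _ _⟩

/-! ### Invariants of a diagonal action as a monoid algebra -/

variable {k : Type u} [Field k] {G : Type w} {ι : Type}

/-- The action of `g` on polynomials by scaling the variables. -/
def scaleVars (c : ι → G → kˣ) (g : G) : MvPolynomial ι k →ₐ[k] MvPolynomial ι k :=
  MvPolynomial.aeval fun i => (c i g : k) • MvPolynomial.X i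

theorem equivMvPolynomial_coordAction [Group G] {V : Type u} [AddCommGroup V] [Module k V]
    (ρ : Representation k G V)
    (b : Module.Basis ι k (Module.Dual k V)) (c : ι → G → kˣ)
    (hc : ∀ i g, ρ.dual g (b i) = (c i g : k) • b i) (g : G) (f : CoordRing k V) :
    SymmetricAlgebra.equivMvPolynomial b (coordAction ρ g f) =
      scaleVars c g (SymmetricAlgebra.equivMvPolynomial b f) := by
  let E := (SymmetricAlgebra.equivMvPolynomial b).toAlgHom
  suffices h : E.comp (coordAction ρ g) = (scaleVars c g).comp E from congr($h f)
  apply SymmetricAlgebra.algHom_ext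
  refine b.ext fun i => ?_
  change SymmetricAlgebra.equivMvPolynomial b
    (SymmetricAlgebra.lift (SymmetricAlgebra.ι k (Module.Dual k V) ∘ₗ ρ.dual g)
      (SymmetricAlgebra.ι k _ (b i))) =
    scaleVars c g (SymmetricAlgebra.equivMvPolynomial b (SymmetricAlgebra.ι k _ (b i)))
  rw [SymmetricAlgebra.lift_ι_apply, LinearMap.comp_apply, hc, map_smul, map_smul,
    SymmetricAlgebra.equivMvPolynomial_ι_apply, scaleVars, MvPolynomial.aeval_X]

variable [Fintype ι]

/-- The exponents of the Laurent monomials that are invariant under a diagonal action. -/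
def invariantExponents (c : ι → G → kˣ) : AddSubgroup (ι → ℤ) where
  carrier := {a | ∀ g, ∏ i, c i g ^ a i = 1}
  zero_mem' g := by simp
  add_mem' {a b} ha hb g := by
    simp only [Pi.add_apply, zpow_add, Finset.prod_mul_distrib]
    rw [ha g, hb g, one_mul]
  neg_mem' {a} ha g := by
    simp only [Pi.neg_apply, zpow_neg, Finset.prod_inv_distrib]
    rw [ha g, inv_one]

theorem smul_mem_invariantExponents {c : ι → G → kˣ} {N : ℕ} (hc : ∀ i g, c i g ^ N = 1)
    (a : ι → ℤ) : N • a ∈ invariantExponents c := fun g =>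
  Finset.prod_eq_one fun i _ => by
    rw [Pi.smul_apply, nsmul_eq_mul, zpow_mul, zpow_natCast, hc, one_zpow]

theorem coeff_scaleVars (c : ι → G → kˣ) (g : G) (p : MvPolynomial ι k) (m : ι →₀ ℕ) :
    (scaleVars c g p).coeff m = (∏ i, c i g ^ m i : kˣ) * p.coeff m := by
  classical
  induction p using MvPolynomial.induction_on' with
  | monomial m' r =>
    have : scaleVars c g (MvPolynomial.monomial m' r) =
        MvPolynomial.monomial m' ((∏ i, c i g ^ m' i : kˣ) * r) := by
      rw [scaleVars, MvPolynomial.aeval_monomial, Finsupp.prod_fintype _ _ (fun _ => pow_zero _)]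
      simp only [smul_pow]
      rw [Finset.prod_smul, MvPolynomial.monomial_eq, Finsupp.prod_fintype _ _ (fun _ => pow_zero _),
        map_mul, MvPolynomial.smul_eq_C_mul, MvPolynomial.algebraMap_eq]
      push_cast
      ring
    rw [this, MvPolynomial.coeff_monomial, MvPolynomial.coeff_monomial]
    split_ifs with h
    · rw [h]
    · rw [mul_zero]
  | add p q hp hq => rw [map_add, MvPolynomial.coeff_add, hp, hq, MvPolynomial.coeff_add, mul_add]

/-- Distinct monomials cannot compensate each other: each coefficient is scaled separately, so every
nonzero one forces its scaling factor to be `1`. -/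
theorem scaleVars_eq_self_iff (c : ι → G → kˣ) (p : MvPolynomial ι k) :
    (∀ g, scaleVars c g p = p) ↔
      ∀ m ∈ p.support, (fun i => (m i : ℤ)) ∈ invariantExponents c := by
  constructor
  · intro h m hm g
    have := coeff_scaleVars c g p m
    rw [h g] at this
    have := mul_right_cancel₀ (MvPolynomial.mem_support_iff.mp hm) ((one_mul _).trans this)
    exact Units.ext (by simpa using this.symm)
  · intro h g
    ext m
    rw [coeff_scaleVars]
    by_cases hm : m ∈ p.support
    · have := h m hm g
      simp only [zpow_natCast] at this
      rw [this, Units.val_one, one_mul]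
    · rw [MvPolynomial.notMem_support_iff.mp hm, mul_zero]

/-- The lattice points of a cone of nonnegative vectors, as exponents of monomials. -/
def latticeConeToFinsupp (H : AddSubgroup (ι → ℤ)) :
    latticeCone H ∅ Finset.univ →+ (ι →₀ ℕ) where
  toFun a := Finsupp.equivFunOnFinite.symm fun i => (a.1 i).toNat
  map_zero' := by ext i; simp
  map_add' a b := by
    ext i
    simpa using Int.toNat_add (a.2.2.1 i (Finset.notMem_empty i)) (b.2.2.1 i (Finset.notMem_empty i))

theorem latticeConeToFinsupp_apply {H : AddSubgroup (ι → ℤ)} (a : latticeCone H ∅ Finset.univ)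
    (i : ι) : (latticeConeToFinsupp H a i : ℤ) = a.1 i := by
  simpa [latticeConeToFinsupp] using a.2.2.1 i (Finset.notMem_empty i)

theorem latticeConeToFinsupp_injective (H : AddSubgroup (ι → ℤ)) :
    Function.Injective (latticeConeToFinsupp H) := fun a b h => Subtype.ext (funext fun i => by
  rw [← latticeConeToFinsupp_apply, ← latticeConeToFinsupp_apply, h])

theorem mem_range_latticeConeToFinsupp {H : AddSubgroup (ι → ℤ)} {m : ι →₀ ℕ} :
    m ∈ Set.range (latticeConeToFinsupp H) ↔ (fun i => (m i : ℤ)) ∈ H := by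
  constructor
  · rintro ⟨a, rfl⟩
    simp only [latticeConeToFinsupp_apply]
    exact a.2.1
  · intro h
    refine ⟨⟨_, h, fun i _ => Int.natCast_nonneg _, fun i _ hi => absurd (Finset.mem_univ i) hi⟩, ?_⟩
    ext i
    exact Int.ofNat_inj.mp (latticeConeToFinsupp_apply _ i)

theorem mem_range_mapDomain_latticeCone {H : AddSubgroup (ι → ℤ)} {p : MvPolynomial ι k} :
    p ∈ (mapDomainAlgHom k k (latticeConeToFinsupp H)).range ↔
      ∀ m ∈ p.support, (fun i => (m i : ℤ)) ∈ H := by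
  classical
  constructor
  · rintro ⟨f, rfl⟩ m hm
    -- `MvPolynomial` is unfolded to the monoid algebra of `ι →₀ ℕ`.
    have hm' : m ∈ (f.coeff.mapDomain (latticeConeToFinsupp H)).support := hm
    obtain ⟨a, -, rfl⟩ := Finset.mem_image.mp (Finsupp.mapDomain_support hm')
    exact mem_range_latticeConeToFinsupp.mp ⟨a, rfl⟩
  · intro h
    exact ⟨_, mapDomain_comapDomain (x := p) (fun m hm => mem_range_latticeConeToFinsupp.mpr (h m hm))
      (latticeConeToFinsupp_injective H)⟩

/-- The invariant functions of a diagonal representation form a monoid algebra. -/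
def invariantsEquiv [Group G] {V : Type u} [AddCommGroup V] [Module k V]
    (ρ : Representation k G V)
    (b : Module.Basis ι k (Module.Dual k V)) (c : ι → G → kˣ)
    (hc : ∀ i g, ρ.dual g (b i) = (c i g : k) • b i) :
    AddMonoidAlgebra k (latticeCone (invariantExponents c) ∅ Finset.univ) ≃ₐ[k] invariants ρ :=
  let F : AddMonoidAlgebra k (latticeCone (invariantExponents c) ∅ Finset.univ) →ₐ[k]
      CoordRing k V :=
    (SymmetricAlgebra.equivMvPolynomial b).symm.toAlgHom.comp
      (mapDomainAlgHom k k (latticeConeToFinsupp (invariantExponents c)))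
  have hF : Function.Injective F := (SymmetricAlgebra.equivMvPolynomial b).symm.injective.comp
    (mapDomain_injective (latticeConeToFinsupp_injective _))
  have hrange : F.range = invariants ρ := by
    ext f
    have h₁ : f ∈ F.range ↔ SymmetricAlgebra.equivMvPolynomial b f ∈
        (mapDomainAlgHom k k (latticeConeToFinsupp (invariantExponents c))).range :=
      exists_congr fun x => (SymmetricAlgebra.equivMvPolynomial b).symm_apply_eq
    rw [h₁, mem_range_mapDomain_latticeCone, ← scaleVars_eq_self_iff]
    refine forall_congr' fun g => ?_
    rw [← equivMvPolynomial_coordAction ρ b c hc]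
    exact (SymmetricAlgebra.equivMvPolynomial b).injective.eq_iff
  (AlgEquiv.ofInjective F hF).trans (Subalgebra.equivOfEq _ _ hrange)

end Diagonal

end Motivic

end

/-- For a representation of a finite abelian group `G` on a vector space `V` of finite dimension
`n` over an algebraically closed field `k` of characteristic zero, the class of the orbit space
`G\V` in `K₀(𝒱_k)` is `𝕃 ^ n`. -/
theorem lemma5p1 {k : Type u} [Field k] [IsAlgClosed k] [CharZero k]
    {G : Type w} [CommGroup G] [Finite G]
    {V : Type u} [AddCommGroup V] [Module k V] [FiniteDimensional k V]
    (ρ : Representation k G V) (n : ℕ) (hn : Module.finrank k V = n) :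
    Motivic.K0.cls (Motivic.orbitSpace ρ) = Motivic.K0.lefschetz k ^ n := by
  -- It is the dual that is diagonalized: the coordinate functions must be eigenvectors.
  obtain ⟨b, c, hc, hpow⟩ := Motivic.exists_basis_forall_smul ρ.dual
    (Subspace.dual_finrank_eq.trans hn)
  let e := Motivic.invariantsEquiv ρ b c hc
  have : Algebra.FiniteType k (AddMonoidAlgebra k
      (Motivic.latticeCone (Motivic.invariantExponents c) ∅ Finset.univ)) :=
    .equiv inferInstance e.symm
  -- Here `N = |G|`, `S = ∅` and `T` is the set of all coordinates.
  rw [Motivic.orbitSpace, ← Motivic.K0.cls_ofAlgebra_congr e,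
    Motivic.K0.cls_latticeCone k Nat.card_pos.ne' (Motivic.smul_mem_invariantExponents hpow) _ _
      (Finset.disjoint_empty_left _), Finset.card_empty, pow_zero, one_mul, Finset.card_univ,
    Fintype.card_fin]
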